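/- Let $n\in\mathbb N$, $1<p<\infty$, $\beta<p-1$, and let $\Omega\subset\mathbb R^n$ be open, with complement $\Omega^c=\mathbb R^n\setminus\Omega$ and $d_\Omega(x)=\operatorname{dist}(x,\Omega^c)$ (with $\operatorname{dist}(x,\emptyset)=\infty$). For $E\subset\mathbb R^n$, the upper Assouad dimension $\overline{\dim}_A(E)$ is the infimum of all $s\ge 0$ for which there is $C\ge 1$ such that for all $x\in E$ and all $0<r<R<\operatorname{diam}(E)$ the set $E\cap B(x,R)$ can be covered by at most $C(r/R)^{-s}$ balls of radius $r$. The lower Assouad dimension $\underline{\dim}_A(E)$ is the supremum of all $t\ge 0$ for which there is $c>0$ such that for all $x\in E$ and all $0<r<R<\operatorname{diam}(E)$ at least $c(r/R)^{-t}$ balls of radius $r$ are needed to cover $E\cap B(x,R)$. Here balls are closed, and $\operatorname{diam}(E)=\infty$ if $E$ is unbounded. Suppose that $$\overline{\dim}_A(\Omega^c)<n-p+\beta ,$$ or that $$\underline{\dim}_A(\Omega^c)>n-p+\beta \quad\text{and, in case } \Omega \text{ is unbounded, } \Omega^c \text{ is unbounded as well.}$$ Then $\Omega$ admits a $(p,\beta)$-Hardy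 inequality: there is a constant $0<C<\infty$ such that $$\int_\Omega |u(x)|^p\, d_\Omega(x)^{\beta-p}\,dx\le C\int_\Omega |\nabla u(x)|^p\, d_\Omega(x)^{\beta}\,dx$$ for every Lipschitz function $u$ with compact support in $\Omega$. -/

import Mathlib

open scoped NNReal ENNReal
open MeasureTheory

/-- `s ≥ 0` is an admissible exponent for the upper Assouad dimension of `E`: there is `C ≥ 1`
such that for all `x ∈ E` and `0 < r < R < diam E` the set `E ∩ B(x, R)` can be covered by at most
`C (r / R) ^ (-s)` closed balls of radius `r`. (The diameter takes the value `∞` on unbounded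
sets.) -/
def IsUpperAssouadExponent {X : Type*} [PseudoMetricSpace X] (E : Set X) (s : ℝ) : Prop :=
  0 ≤ s ∧ ∃ C : ℝ, 1 ≤ C ∧ ∀ x ∈ E, ∀ r R : ℝ, 0 < r → r < R →
    ENNReal.ofReal R < Metric.ediam E →
    ∃ F : Finset X, E ∩ Metric.closedBall x R ⊆ ⋃ y ∈ F, Metric.closedBall y r ∧
      (F.card : ℝ) ≤ C * (r / R) ^ (-s)

/-- `t ≥ 0` is an admissible exponent for the lower Assouad dimension of `E`: there is `c > 0`
such that for all `x ∈ E` and `0 < r < R < diam E` at least `c (r / R) ^ (-t)` closed balls of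
radius `r` are needed to cover `E ∩ B(x, R)`. -/
def IsLowerAssouadExponent {X : Type*} [PseudoMetricSpace X] (E : Set X) (t : ℝ) : Prop :=
  0 ≤ t ∧ ∃ c : ℝ, 0 < c ∧ ∀ x ∈ E, ∀ r R : ℝ, 0 < r → r < R →
    ENNReal.ofReal R < Metric.ediam E →
    ∀ F : Finset X, E ∩ Metric.closedBall x R ⊆ ⋃ y ∈ F, Metric.closedBall y r →
      c * (r / R) ^ (-t) ≤ (F.card : ℝ)

/-- The upper Assouad dimension: the infimum of the admissible exponents, an extended real number
(`⊤` if there is no admissible exponent). -/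
noncomputable def upperAssouadDim {X : Type*} [PseudoMetricSpace X] (E : Set X) : EReal :=
  sInf ((fun s : ℝ => (s : EReal)) '' {s : ℝ | IsUpperAssouadExponent E s})

/-- The lower Assouad dimension: the supremum of the admissible exponents, an extended real
number. -/
noncomputable def lowerAssouadDim {X : Type*} [PseudoMetricSpace X] (E : Set X) : EReal :=
  sSup ((fun t : ℝ => (t : EReal)) '' {t : ℝ | IsLowerAssouadExponent E t})

/-- `u ∈ Lip₀(Ω)`: `u` is a Lipschitz function whose support is a compact subset of `Ω`. The
function is regarded as extended by zero to the whole space; for `Ω` open this is the same as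
being Lipschitz on `Ω` with compact support in `Ω`. -/
def MemLipZero {X : Type*} [PseudoMetricSpace X] (Ω : Set X) (u : X → ℝ) : Prop :=
  (∃ L : ℝ≥0, LipschitzWith L u) ∧ HasCompactSupport u ∧ tsupport u ⊆ Ω

/-- `Ω ⊆ ℝⁿ` admits a `(p, β)`-Hardy inequality: there is a finite constant `C > 0` with
`∫_Ω |u|^p d_Ω^(β - p) dx ≤ C ∫_Ω |∇u|^p d_Ω^β dx` for all `u ∈ Lip₀(Ω)`, where
`d_Ω(x) = dist(x, Ωᶜ)`. The integrals are those of `[0, ∞]`-valued functions, and the distance to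
the empty set is `∞`. -/
def AdmitsHardy {n : ℕ} (Ω : Set (EuclideanSpace ℝ (Fin n))) (p β : ℝ) : Prop :=
  ∃ C : ℝ≥0, 0 < C ∧ ∀ u : EuclideanSpace ℝ (Fin n) → ℝ, MemLipZero Ω u →
    ∫⁻ x in Ω, ‖u x‖ₑ ^ p * Metric.infEDist x Ωᶜ ^ (β - p) ≤
      (C : ℝ≥0∞) * ∫⁻ x in Ω, ‖gradient u x‖ₑ ^ p * Metric.infEDist x Ωᶜ ^ β

/-! Put q = p - β > 1 and let d be the distance to Ωᶜ. It suffices to prove the L¹ inequality ∫ |v|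
d^(-q) ≤ C ∫ |∇v| d^(1-q); applied to v = |u|^p, it gives the claim by the chain rule and Hölder
(`hardy_of_hardy_one`). For the L¹ inequality, compare v on {d < R} with its values on {d < τR}
inside balls of radius ρR. Averaging, with the translation estimate for the error, gives ∫_{d<R} |v|
≤ A ∫_{d<τR} |v| + BR ∫_{d<(1+ρ)R} |∇v|, where A is a ratio of volumes (`lintegral_sublevel_le`).
Integrating against R^(-q-1) dR turns sublevel integrals into weighted ones, and the first term on
the right returns with factor A τ^q. If A τ^q ≤ 1/2 it is absorbed, since compact support makes the
left side finite. The dimension hypotheses make A τ^q small. Small upper dimension: on huge balls (ρ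
= K, τ = K + 1) the neighbourhood {d < R} occupies little, and A τ^q ≲ K^(s+q-n). Large lower
dimension: even the thin neighbourhood {d < R/K} has substantial volume in balls of radius 3R, and A
τ^q ≲ K^(n-q-t). -/

/-! ### Translation estimate and averaging over balls -/

section Translation

variable {X : Type*} [NormedAddCommGroup X] [InnerProductSpace ℝ X]

theorem enorm_sub_le_lintegral_deriv {L : ℝ≥0} {g : ℝ → ℝ} (hg : LipschitzWith L g) :
    ‖g 1 - g 0‖ₑ ≤ ∫⁻ s in Set.Icc (0 : ℝ) 1, ‖deriv g s‖ₑ := by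
  have h := (hg.lipschitzOnWith (s := Set.uIcc 0 1)).absolutelyContinuousOnInterval
  rw [← h.integral_deriv_eq_sub, intervalIntegral.integral_of_le zero_le_one,
    ← integral_Icc_eq_integral_Ioc]
  exact enorm_integral_le_lintegral_enorm _

theorem hasDerivAt_comp_add_smul [CompleteSpace X] {v : X → ℝ} {x h : X} {s : ℝ}
    (hv : DifferentiableAt ℝ v (x + s • h)) :
    HasDerivAt (fun s : ℝ => v (x + s • h)) (inner ℝ (gradient v (x + s • h)) h) s := by
  have h1 := hv.hasGradientAt.hasFDerivAt
  have h2 : HasDerivAt (fun s : ℝ => x + s • h) h s := by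
    simpa using ((hasDerivAt_id s).smul_const h).const_add x
  have h3 := h1.comp_hasDerivAt s h2
  rwa [InnerProductSpace.toDual_apply_apply] at h3

variable [FiniteDimensional ℝ X] [MeasurableSpace X] [BorelSpace X]
  {μ : Measure X} [μ.IsAddHaarMeasure]

theorem measurable_gradient (v : X → ℝ) : Measurable (gradient v) := by
  unfold gradient
  exact (InnerProductSpace.toDual ℝ X).symm.continuous.measurable.comp (measurable_fderiv ℝ v)

theorem lintegral_enorm_translate_sub_le {L : ℝ≥0} {v : X → ℝ} (hv : LipschitzWith L v) (h : X)
    {A B : Set X} (hA : MeasurableSet A) (hB : MeasurableSet B)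
    (hAB : ∀ x ∈ A, ∀ s ∈ Set.Icc (0 : ℝ) 1, x + s • h ∈ B) :
    ∫⁻ x in A, ‖v (x + h) - v x‖ₑ ∂μ ≤ ‖h‖ₑ * ∫⁻ y in B, ‖gradient v y‖ₑ ∂μ := by
  have hgm : Measurable fun y => B.indicator (fun y => ‖gradient v y‖ₑ) y :=
    (measurable_gradient v).enorm.indicator hB
  -- For fixed s, Rademacher and translation invariance give differentiability at x + s • h for
  -- almost every x; Fubini exchanges the two quantifiers.
  have hdiff : ∀ᵐ x ∂μ, ∀ᵐ s ∂(volume.restrict (Set.Icc (0 : ℝ) 1)),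
      DifferentiableAt ℝ v (x + s • h) := by
    have hm : MeasurableSet {z : X × ℝ | DifferentiableAt ℝ v (z.1 + z.2 • h)} :=
      (measurableSet_of_differentiableAt ℝ v).preimage (by fun_prop)
    have hm' : MeasurableSet {z : ℝ × X | DifferentiableAt ℝ v (z.2 + z.1 • h)} :=
      (measurableSet_of_differentiableAt ℝ v).preimage (by fun_prop)
    rw [← Measure.ae_prod_iff_ae_ae hm]
    have : ∀ᵐ z ∂((volume.restrict (Set.Icc (0 : ℝ) 1)).prod μ),
        DifferentiableAt ℝ v (z.2 + z.1 • h) := by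
      rw [Measure.ae_prod_iff_ae_ae hm']
      refine Filter.Eventually.of_forall fun s => ?_
      exact (measurePreserving_add_right μ (s • h)).quasiMeasurePreserving.ae
        hv.ae_differentiableAt
    exact (Measure.measurePreserving_swap (μ := μ)
      (ν := volume.restrict (Set.Icc (0 : ℝ) 1))).quasiMeasurePreserving.ae this
  have hpt : ∀ᵐ x ∂μ, x ∈ A → ‖v (x + h) - v x‖ₑ ≤
      ‖h‖ₑ * ∫⁻ s in Set.Icc (0 : ℝ) 1, B.indicator (fun y => ‖gradient v y‖ₑ) (x + s • h) := by
    filter_upwards [hdiff] with x hx hxA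
    have hL : LipschitzWith (L * ‖h‖₊) (fun s : ℝ => v (x + s • h)) := by
      refine hv.comp (LipschitzWith.of_dist_le_mul fun a b => ?_)
      rw [dist_add_left, dist_eq_norm, ← sub_smul, norm_smul, mul_comm]
      simp [Real.dist_eq]
    have h1 := enorm_sub_le_lintegral_deriv hL
    simp only [one_smul, zero_smul, add_zero] at h1
    refine h1.trans ?_
    rw [← lintegral_const_mul' _ _ enorm_ne_top]
    refine lintegral_mono_ae ?_
    filter_upwards [hx, ae_restrict_mem measurableSet_Icc] with s hs hsI
    rw [(hasDerivAt_comp_add_smul hs).deriv,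
      Set.indicator_of_mem (hAB x hxA s hsI), mul_comm]
    rw [← ofReal_norm, ← ofReal_norm, ← ofReal_norm, ← ENNReal.ofReal_mul (norm_nonneg _)]
    exact ENNReal.ofReal_le_ofReal (norm_inner_le_norm _ _)
  calc ∫⁻ x in A, ‖v (x + h) - v x‖ₑ ∂μ
      ≤ ∫⁻ x in A, ‖h‖ₑ * (∫⁻ s in Set.Icc (0 : ℝ) 1,
          B.indicator (fun y => ‖gradient v y‖ₑ) (x + s • h)) ∂μ :=
        lintegral_mono_ae ((ae_restrict_iff' hA).2 hpt)
    _ ≤ ∫⁻ x, ‖h‖ₑ * (∫⁻ s in Set.Icc (0 : ℝ) 1,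
          B.indicator (fun y => ‖gradient v y‖ₑ) (x + s • h)) ∂μ := setLIntegral_le_lintegral _ _
    _ = ‖h‖ₑ * ∫⁻ x, (∫⁻ s in Set.Icc (0 : ℝ) 1,
          B.indicator (fun y => ‖gradient v y‖ₑ) (x + s • h)) ∂μ :=
        lintegral_const_mul' _ _ enorm_ne_top
    _ = ‖h‖ₑ * ∫⁻ s in Set.Icc (0 : ℝ) 1, ∫⁻ x,
          B.indicator (fun y => ‖gradient v y‖ₑ) (x + s • h) ∂μ := by
        rw [lintegral_lintegral_swap]
        exact (hgm.comp (by fun_prop :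
          Measurable fun z : X × ℝ => z.1 + z.2 • h)).aemeasurable
    _ = ‖h‖ₑ * ∫⁻ y in B, ‖gradient v y‖ₑ ∂μ := by
        congr 1
        simp_rw [lintegral_add_right_eq_self (μ := μ)
          (fun y => B.indicator (fun y => ‖gradient v y‖ₑ) y)]
        simp [lintegral_indicator hB]

/-- Integrals over neighbourhoods `{d < R}` and `{d < S}` compared by averaging over balls of
radius `ρ`. -/
theorem lintegral_sublevel_le {L : ℝ≥0} {v : X → ℝ} (hv : LipschitzWith L v) {d : X → ℝ}
    (hd : LipschitzWith 1 d) {R S ρ : ℝ} {m M : ℝ≥0∞} (hm' : m ≠ ⊤)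
    (hm : ∀ x, d x < R → m ≤ μ (Metric.ball x ρ ∩ {y | d y < S}))
    (hM : ∀ y, μ (Metric.ball y ρ ∩ {x | d x < R}) ≤ M) :
    m * ∫⁻ x in {x | d x < R}, ‖v x‖ₑ ∂μ ≤
      M * ∫⁻ x in {x | d x < S}, ‖v x‖ₑ ∂μ +
        μ (Metric.ball 0 ρ) * (ENNReal.ofReal ρ *
          ∫⁻ x in {x | d x < R + ρ}, ‖gradient v x‖ₑ ∂μ) := by
  have hmeas : ∀ T, MeasurableSet {x | d x < T} := fun T =>
    (isOpen_Iio.preimage hd.continuous).measurableSet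
  have hvm : Measurable fun x => ‖v x‖ₑ := hv.continuous.measurable.enorm
  have hvc := hv.continuous
  -- The kernel 1_{|x-y|<ρ}, written through y - x so that joint measurability is immediate. It is
  -- symmetric: its mass in y gives m, its mass in x gives M.
  set K : X → X → ℝ≥0∞ := fun x y => (Metric.ball (0 : X) ρ).indicator 1 (y - x) with hK
  have hKm : Measurable (Function.uncurry K) :=
    (measurable_one.indicator Metric.isOpen_ball.measurableSet).comp
      (measurable_snd.sub measurable_fst)
  have hK1 : ∀ x y, K x y = (Metric.ball x ρ).indicator 1 y := fun x y => by
    classical simp [hK, Set.indicator_apply, dist_eq_norm]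
  have hK2 : ∀ x y, K x y = (Metric.ball y ρ).indicator 1 x := fun x y => by
    classical simp [hK, Set.indicator_apply, dist_eq_norm, norm_sub_rev x y]
  have hmK : ∀ x T, ∫⁻ y in {y | d y < T}, K x y ∂μ = μ (Metric.ball x ρ ∩ {y | d y < T}) := by
    intro x T
    simp_rw [hK1]
    rw [lintegral_indicator_one Metric.isOpen_ball.measurableSet,
      Measure.restrict_apply Metric.isOpen_ball.measurableSet]
  have hmK' : ∀ y T, ∫⁻ x in {x | d x < T}, K x y ∂μ = μ (Metric.ball y ρ ∩ {x | d x < T}) := by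
    intro y T
    simp_rw [hK2]
    rw [lintegral_indicator_one Metric.isOpen_ball.measurableSet,
      Measure.restrict_apply Metric.isOpen_ball.measurableSet]
  have hKx : ∀ x, Measurable (K x) := fun x => hKm.comp (measurable_const.prodMk measurable_id)
  have hKy : ∀ y, Measurable fun x => K x y :=
    fun y => hKm.comp (measurable_id.prodMk measurable_const)
  calc m * ∫⁻ x in {x | d x < R}, ‖v x‖ₑ ∂μ
      = ∫⁻ x in {x | d x < R}, m * ‖v x‖ₑ ∂μ := (lintegral_const_mul' _ _ hm').symm
    _ ≤ ∫⁻ x in {x | d x < R}, (∫⁻ y in {y | d y < S}, K x y * ‖v y‖ₑ ∂μ +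
          ∫⁻ y, K x y * ‖v y - v x‖ₑ ∂μ) ∂μ := by
        refine setLIntegral_mono' (hmeas R) fun x hx => ?_
        calc m * ‖v x‖ₑ ≤ (∫⁻ y in {y | d y < S}, K x y ∂μ) * ‖v x‖ₑ := by
              rw [hmK]; gcongr; exact hm x hx
          _ = ∫⁻ y in {y | d y < S}, K x y * ‖v x‖ₑ ∂μ :=
              (lintegral_mul_const' _ _ enorm_ne_top).symm
          _ ≤ ∫⁻ y in {y | d y < S}, (K x y * ‖v y‖ₑ + K x y * ‖v y - v x‖ₑ) ∂μ := by
              refine lintegral_mono fun y => ?_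
              rw [← mul_add]
              gcongr
              calc ‖v x‖ₑ = ‖v y - (v y - v x)‖ₑ := by congr 1; ring
                _ ≤ _ := enorm_sub_le
          _ = (∫⁻ y in {y | d y < S}, K x y * ‖v y‖ₑ ∂μ) +
              ∫⁻ y in {y | d y < S}, K x y * ‖v y - v x‖ₑ ∂μ :=
              lintegral_add_left ((hKx x).mul hvm) _
          _ ≤ _ := by gcongr; exact Measure.restrict_le_self
    _ = (∫⁻ x in {x | d x < R}, ∫⁻ y in {y | d y < S}, K x y * ‖v y‖ₑ ∂μ ∂μ) +
          ∫⁻ x in {x | d x < R}, ∫⁻ y, K x y * ‖v y - v x‖ₑ ∂μ ∂μ := by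
        refine lintegral_add_left ?_ _
        exact (hKm.mul (hvm.comp measurable_snd)).lintegral_prod_right'
    _ ≤ _ := by
        gcongr ?_ + ?_
        · rw [lintegral_lintegral_swap
            (hKm.mul (hvm.comp measurable_snd)).aemeasurable]
          calc ∫⁻ y in {y | d y < S}, ∫⁻ x in {x | d x < R}, K x y * ‖v y‖ₑ ∂μ ∂μ
              ≤ ∫⁻ y in {y | d y < S}, M * ‖v y‖ₑ ∂μ := by
                refine lintegral_mono fun y => ?_
                simp only
                rw [lintegral_mul_const _ (hKy y), hmK']
                gcongr
                exact hM y
            _ = _ := lintegral_const_mul _ hvm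
        -- Substitute y = x + h and apply the translation estimate for each h. Since d is
        -- 1-Lipschitz, segments from {d < R} of length below ρ stay in {d < R + ρ}.
        · calc ∫⁻ x in {x | d x < R}, ∫⁻ y, K x y * ‖v y - v x‖ₑ ∂μ ∂μ
              = ∫⁻ x in {x | d x < R}, ∫⁻ h in Metric.ball 0 ρ, ‖v (x + h) - v x‖ₑ ∂μ ∂μ := by
                refine lintegral_congr fun x => ?_
                rw [← lintegral_add_left_eq_self (μ := μ) _ x,
                  ← lintegral_indicator Metric.isOpen_ball.measurableSet]
                refine lintegral_congr fun h => ?_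
                by_cases hh : h ∈ Metric.ball (0 : X) ρ <;> simp [hK, hh]
            _ = ∫⁻ h in Metric.ball 0 ρ, ∫⁻ x in {x | d x < R}, ‖v (x + h) - v x‖ₑ ∂μ ∂μ := by
                refine lintegral_lintegral_swap ?_
                refine Measurable.aemeasurable ?_
                refine Measurable.enorm ?_
                exact ((hvc.comp (continuous_fst.add continuous_snd)).sub
                  (hvc.comp continuous_fst)).measurable
            _ ≤ ∫⁻ h in Metric.ball (0 : X) ρ, (ENNReal.ofReal ρ *
                  ∫⁻ x in {x | d x < R + ρ}, ‖gradient v x‖ₑ ∂μ) ∂μ := by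
                refine setLIntegral_mono' Metric.isOpen_ball.measurableSet fun h hh => ?_
                have hh' : ‖h‖ < ρ := by simpa using hh
                refine (lintegral_enorm_translate_sub_le hv h (hmeas R) (hmeas (R + ρ)) ?_).trans ?_
                · intro x hx s hs
                  have h1 := hd.dist_le_mul (x + s • h) x
                  have h2 : ‖s • h‖ ≤ ‖h‖ := by
                    rw [norm_smul, Real.norm_of_nonneg hs.1]
                    exact mul_le_of_le_one_left (norm_nonneg _) hs.2
                  simp only [NNReal.coe_one, one_mul, dist_self_add_left, Real.dist_eq] at h1
                  have h3 := (abs_le.1 h1).2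
                  simp only [Set.mem_ofPred_eq] at hx ⊢
                  linarith
                · gcongr
                  rw [← ofReal_norm]
                  exact ENNReal.ofReal_le_ofReal hh'.le
            _ = _ := by rw [setLIntegral_const, mul_comm]

end Translation

/-! ### Integration over scales and absorption -/

theorem lintegral_Ioi_ofReal_rpow {a c : ℝ} (ha : a < -1) (hc : 0 < c) :
    ∫⁻ R in Set.Ioi c, ENNReal.ofReal (R ^ a) = ENNReal.ofReal (c ^ (a + 1) / (-a - 1)) := by
  rw [← ofReal_integral_eq_lintegral_ofReal (integrableOn_Ioi_rpow_of_lt ha hc),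
    integral_Ioi_rpow_of_lt ha hc]
  · congr 1
    rw [neg_div, ← div_neg]
    congr 1
    ring
  · filter_upwards [ae_restrict_mem measurableSet_Ioi] with R hR
    exact Real.rpow_nonneg (hc.trans hR).le _

section

variable {X : Type*} [MeasurableSpace X] {μ : Measure X} [SFinite μ]

/-- By Tonelli, each x contributes f x times the integral of R^a over R > d x / τ, which converges
at infinity because a < -1. Where d x ≤ 0 that integral would diverge at 0, so f must vanish there.
-/
theorem lintegral_rpow_mul_setLIntegral_sublevel {f : X → ℝ≥0∞} (hf : Measurable f) {d : X → ℝ}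
    (hd : Measurable d) (hfd : ∀ x, d x ≤ 0 → f x = 0) {a τ : ℝ} (ha : a < -1) (hτ : 0 < τ) :
    ∫⁻ R in Set.Ioi (0 : ℝ), ENNReal.ofReal (R ^ a) * ∫⁻ x in {x | d x < τ * R}, f x ∂μ =
      ENNReal.ofReal (τ ^ (-a - 1) / (-a - 1)) *
        ∫⁻ x, f x * ENNReal.ofReal (d x ^ (a + 1)) ∂μ := by
  have hS : MeasurableSet {z : ℝ × X | d z.2 < τ * z.1} :=
    measurableSet_lt (hd.comp measurable_snd) (measurable_fst.const_mul τ)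
  have hF : Measurable fun z : ℝ × X => ENNReal.ofReal (z.1 ^ a) *
      {z : ℝ × X | d z.2 < τ * z.1}.indicator (fun z => f z.2) z :=
    (by fun_prop : Measurable fun z : ℝ × X => ENNReal.ofReal (z.1 ^ a)).mul
      ((hf.comp measurable_snd).indicator hS)
  calc ∫⁻ R in Set.Ioi (0 : ℝ), ENNReal.ofReal (R ^ a) * ∫⁻ x in {x | d x < τ * R}, f x ∂μ
      = ∫⁻ R in Set.Ioi (0 : ℝ), ∫⁻ x, ENNReal.ofReal (R ^ a) *
          {z : ℝ × X | d z.2 < τ * z.1}.indicator (fun z => f z.2) (R, x) ∂μ := by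
        refine lintegral_congr fun R => ?_
        rw [← lintegral_indicator (measurableSet_lt hd measurable_const),
          ← lintegral_const_mul' _ _ ENNReal.ofReal_ne_top]
        rfl
    _ = ∫⁻ x, (∫⁻ R in Set.Ioi (0 : ℝ), ENNReal.ofReal (R ^ a) *
          {z : ℝ × X | d z.2 < τ * z.1}.indicator (fun z => f z.2) (R, x)) ∂μ :=
        lintegral_lintegral_swap hF.aemeasurable
    _ = ∫⁻ x, ENNReal.ofReal (τ ^ (-a - 1) / (-a - 1)) *
          (f x * ENNReal.ofReal (d x ^ (a + 1))) ∂μ := by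
        refine lintegral_congr fun x => ?_
        rcases le_or_gt (d x) 0 with hx | hx
        · classical simp [hfd x hx, Set.indicator_apply]
        have hc : 0 < d x / τ := div_pos hx hτ
        calc ∫⁻ R in Set.Ioi (0 : ℝ), ENNReal.ofReal (R ^ a) *
              {z : ℝ × X | d z.2 < τ * z.1}.indicator (fun z => f z.2) (R, x)
            = ∫⁻ R in Set.Ioi (0 : ℝ), (Set.Ioi (d x / τ)).indicator
                (fun R => f x * ENNReal.ofReal (R ^ a)) R := by
              refine lintegral_congr fun R => ?_
              by_cases h : d x < τ * R
              · have : d x / τ < R := by rwa [div_lt_iff₀ hτ, mul_comm]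
                simp [h, this, mul_comm]
              · have : ¬ d x / τ < R := by rwa [div_lt_iff₀ hτ, mul_comm]
                simp [h, this]
          _ = ∫⁻ R in Set.Ioi (d x / τ), f x * ENNReal.ofReal (R ^ a) := by
              rw [setLIntegral_indicator measurableSet_Ioi, Set.inter_eq_left.2]
              exact Set.Ioi_subset_Ioi hc.le
          _ = f x * ENNReal.ofReal ((d x / τ) ^ (a + 1) / (-a - 1)) := by
              rw [lintegral_const_mul _ (by fun_prop), lintegral_Ioi_ofReal_rpow ha hc]
          _ = _ := by
              rw [mul_left_comm, ← ENNReal.ofReal_mul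
                (div_nonneg (Real.rpow_nonneg hτ.le _) (by linarith))]
              congr 2
              rw [Real.div_rpow hx.le hτ.le, show -a - 1 = -(a + 1) by ring,
                Real.rpow_neg hτ.le]
              ring
    _ = _ := lintegral_const_mul' _ _ ENNReal.ofReal_ne_top

/-- A Hardy inequality from a comparison of integrals over sublevel sets of `d` at all scales. -/
theorem lintegral_mul_rpow_le_of_sublevel {f g : X → ℝ≥0∞} (hf : Measurable f)
    (hg : Measurable g) {d : X → ℝ} (hd : Measurable d) (hfd : ∀ x, d x ≤ 0 → f x = 0)
    (hgd : ∀ x, d x ≤ 0 → g x = 0) {q τ A B M : ℝ} (hq : 1 < q) (hτ : 0 < τ) (hA : 0 ≤ A)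
    (hB : 0 < B) (hM : 0 < M) (hAτ : A * τ ^ q ≤ 1 / 2)
    (hR : ∀ R : ℝ, 0 < R → ∫⁻ x in {x | d x < R}, f x ∂μ ≤
      ENNReal.ofReal A * ∫⁻ x in {x | d x < τ * R}, f x ∂μ +
        ENNReal.ofReal (B * R) * ∫⁻ x in {x | d x < M * R}, g x ∂μ)
    (hfin : ∫⁻ x, f x * ENNReal.ofReal (d x ^ (-q)) ∂μ ≠ ⊤) :
    ∫⁻ x, f x * ENNReal.ofReal (d x ^ (-q)) ∂μ ≤
      ENNReal.ofReal (2 * q * B * (M ^ (q - 1) / (q - 1))) *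
        ∫⁻ x, g x * ENNReal.ofReal (d x ^ (1 - q)) ∂μ := by
  have hmono : ∀ (f : X → ℝ≥0∞) (τ : ℝ), 0 < τ →
      Measurable fun R : ℝ => ∫⁻ x in {x | d x < τ * R}, f x ∂μ := by
    intro f τ hτ
    refine Monotone.measurable fun R S hRS => ?_
    refine lintegral_mono_set fun x hx => ?_
    have hx' : d x < τ * R := hx
    exact hx'.trans_le (mul_le_mul_of_nonneg_left hRS hτ.le)
  have I1 := lintegral_rpow_mul_setLIntegral_sublevel (μ := μ) hf hd hfd
    (a := -q - 1) (τ := 1) (by linarith) one_pos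
  have I2 := lintegral_rpow_mul_setLIntegral_sublevel (μ := μ) hf hd hfd
    (a := -q - 1) (τ := τ) (by linarith) hτ
  have I3 := lintegral_rpow_mul_setLIntegral_sublevel (μ := μ) hg hd hgd
    (a := -q) (τ := M) (by linarith) hM
  have e1 : -(-q - 1) - 1 = q := by ring
  have e2 : -q - 1 + 1 = -q := by ring
  have e3 : -(-q) - 1 = q - 1 := by ring
  have e4 : -q + 1 = 1 - q := by ring
  simp only [e1, e2, e3, e4, Real.one_rpow, one_mul] at I1 I2 I3
  set H := ∫⁻ x, f x * ENNReal.ofReal (d x ^ (-q)) ∂μ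
  set G := ∫⁻ x, g x * ENNReal.ofReal (d x ^ (1 - q)) ∂μ
  -- The hypothesis integrated against R^(-q-1). The extra factor R in the gradient term raises the
  -- weight to R^(-q), hence the exponent 1 - q in G.
  have key : ENNReal.ofReal (1 / q) * H ≤ ENNReal.ofReal A * (ENNReal.ofReal (τ ^ q / q) * H) +
      ENNReal.ofReal B * (ENNReal.ofReal (M ^ (q - 1) / (q - 1)) * G) := by
    rw [← I1, ← I2, ← I3, ← lintegral_const_mul' _ _ ENNReal.ofReal_ne_top,
      ← lintegral_const_mul' _ _ ENNReal.ofReal_ne_top, ← lintegral_add_left]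
    · refine setLIntegral_mono' measurableSet_Ioi fun R hR0 => ?_
      have hR0' : 0 < R := hR0
      calc _ ≤ ENNReal.ofReal (R ^ (-q - 1)) * (ENNReal.ofReal A *
            ∫⁻ x in {x | d x < τ * R}, f x ∂μ +
            ENNReal.ofReal (B * R) * ∫⁻ x in {x | d x < M * R}, g x ∂μ) := by
              gcongr
              exact hR R hR0
        _ = _ := by
              have : ENNReal.ofReal (R ^ (-q)) =
                  ENNReal.ofReal (R ^ (-q - 1)) * ENNReal.ofReal R := by
                rw [← ENNReal.ofReal_mul (Real.rpow_nonneg hR0'.le _),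
                  Real.rpow_sub_one hR0'.ne', div_mul_cancel₀ _ hR0'.ne']
              rw [this, ENNReal.ofReal_mul hB.le]
              ring
    · exact ((by fun_prop : Measurable fun R : ℝ => ENNReal.ofReal (R ^ (-q - 1))).mul
        (hmono f τ hτ)).const_mul _
  clear_value H G
  have hH : H ≠ ⊤ := hfin
  have hq0 : 0 < q := by linarith
  rcases eq_or_ne G ⊤ with hG | hG
  · rw [hG, ENNReal.mul_top]
    · exact le_top
    · have : 0 < q - 1 := by linarith
      exact (ENNReal.ofReal_pos.2 (by positivity)).ne'
  lift H to ℝ≥0 using hH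
  lift G to ℝ≥0 using hG
  have k := ENNReal.toReal_mono (by finiteness) key
  have hq1 : 0 < q - 1 := by linarith
  rw [ENNReal.toReal_add (by finiteness) (by finiteness)] at k
  simp only [ENNReal.toReal_mul, ENNReal.coe_toReal] at k
  rw [ENNReal.toReal_ofReal (by positivity), ENNReal.toReal_ofReal hA,
    ENNReal.toReal_ofReal (by positivity), ENNReal.toReal_ofReal hB.le,
    ENNReal.toReal_ofReal (by positivity)] at k
  -- Half of the left side, to be subtracted; this is legitimate because H is finite.
  have h2 : A * (τ ^ q / q * (H : ℝ)) ≤ (1 / 2) * (1 / q * H) := by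
    refine le_of_eq_of_le (b := (A * τ ^ q) * (1 / q * H)) (by ring) ?_
    gcongr
  have h3 : (H : ℝ) ≤ 2 * q * B * (M ^ (q - 1) / (q - 1)) * G := by
    have h4 : 1 / q * (H : ℝ) ≤ 2 * (B * (M ^ (q - 1) / (q - 1) * G)) := by linarith
    calc (H : ℝ) = q * (1 / q * H) := by field_simp
      _ ≤ q * (2 * (B * (M ^ (q - 1) / (q - 1) * G))) := by gcongr
      _ = _ := by ring
  rw [← ENNReal.ofReal_coe_nnreal, ← ENNReal.ofReal_coe_nnreal (p := G),
    ← ENNReal.ofReal_mul (by positivity)]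
  exact ENNReal.ofReal_le_ofReal h3

end

/-! ### From the L¹ to the Lᵖ inequality -/

/-- Cancel a^(1/q) from a = a^(1/q) a^(1/p), then raise to the power p. This closes the argument
after Hölder; the cancellation needs a finite. -/
theorem ENNReal.le_rpow_mul_of_le_mul_rpow {a b k : ℝ≥0∞} (ha : a ≠ ⊤) {p q : ℝ}
    (hpq : p.HolderConjugate q) (h : a ≤ k * (a ^ (1 / q) * b ^ (1 / p))) : a ≤ k ^ p * b := by
  rcases eq_or_ne a 0 with rfl | h0
  · exact bot_le
  have hp := hpq.pos
  have hq := hpq.symm.pos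
  have hsum : 1 / q + 1 / p = 1 := by
    have := hpq.inv_add_inv_eq_one
    rw [one_div, one_div]; linarith
  have e : a ^ (1 / q) * a ^ (1 / p) = a := by
    rw [← ENNReal.rpow_add _ _ h0 ha, hsum, ENNReal.rpow_one]
  have h1 : a ^ (1 / q) * a ^ (1 / p) ≤ a ^ (1 / q) * (k * b ^ (1 / p)) := by
    rw [e]; exact h.trans (le_of_eq (by ring))
  have h2 : a ^ (1 / p) ≤ k * b ^ (1 / p) := by
    refine (ENNReal.mul_le_mul_iff_right ?_ ?_).1 h1
    · exact (ENNReal.rpow_pos (pos_iff_ne_zero.2 h0) ha).ne'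
    · exact ENNReal.rpow_ne_top_of_nonneg (by positivity) ha
  have h3 := ENNReal.rpow_le_rpow h2 hp.le
  rwa [ENNReal.mul_rpow_of_nonneg _ _ hp.le, ← ENNReal.rpow_mul, ← ENNReal.rpow_mul,
    one_div_mul_cancel hp.ne', ENNReal.rpow_one, ENNReal.rpow_one] at h3

/-- The power |t|^p is only locally Lipschitz; the bound on u confines t to [-M, M], where the
derivative is at most p M^(p-1). -/
theorem LipschitzWith.abs_rpow_of_bounded {X : Type*} [PseudoMetricSpace X] {L : ℝ≥0} {u : X → ℝ}
    (hu : LipschitzWith L u) {M : ℝ} (hM : ∀ x, |u x| ≤ M) {p : ℝ} (hp : 1 < p) :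
    ∃ L' : ℝ≥0, LipschitzWith L' fun x => |u x| ^ p := by
  have hg : LipschitzOnWith (Real.toNNReal (p * M ^ (p - 1))) (fun t : ℝ => |t| ^ p)
      (Set.Icc (-M) M) := by
    refine (convex_Icc _ _).lipschitzOnWith_of_nnnorm_hasDerivWithin_le
      (fun t _ => (hasDerivAt_abs_rpow t hp).hasDerivWithinAt) fun t ht => ?_
    rw [← norm_toNNReal]
    refine Real.toNNReal_le_toNNReal ?_
    have htM : |t| ≤ M := abs_le.2 ht
    rw [norm_mul, norm_mul, Real.norm_of_nonneg (by linarith : 0 ≤ p),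
      Real.norm_of_nonneg (Real.rpow_nonneg (abs_nonneg _) _), Real.norm_eq_abs, mul_assoc]
    refine mul_le_mul_of_nonneg_left ?_ (by linarith)
    rcases eq_or_ne t 0 with rfl | ht0
    · simp only [abs_zero, mul_zero]
      exact Real.rpow_nonneg ((abs_nonneg _).trans htM) _
    · rw [← Real.rpow_add_one (abs_pos.2 ht0).ne', show p - 2 + 1 = p - 1 by ring]
      exact Real.rpow_le_rpow (abs_nonneg _) htM (by linarith)
  refine ⟨Real.toNNReal (p * M ^ (p - 1)) * L, ?_⟩
  rw [← lipschitzOnWith_univ] at hu ⊢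
  exact hg.comp hu fun x _ => abs_le.1 (hM x)

theorem MemLipZero.abs_rpow {X : Type*} [PseudoMetricSpace X] {Ω : Set X} {u : X → ℝ} (hu : MemLipZero Ω u) {p : ℝ} (hp : 1 < p) :
    MemLipZero Ω fun x => |u x| ^ p := by
  obtain ⟨⟨L, hL⟩, hc, hs⟩ := hu
  obtain ⟨M, hM⟩ := hc.exists_bound_of_continuous hL.continuous
  have h0 : (fun t : ℝ => |t| ^ p) 0 = 0 := by simp [(by linarith : p ≠ 0)]
  refine ⟨hL.abs_rpow_of_bounded hM hp, hc.comp_left (g := fun t : ℝ => |t| ^ p) h0, ?_⟩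
  refine (closure_mono ?_).trans hs
  exact Function.support_comp_subset (g := fun t : ℝ => |t| ^ p) h0 u

/-- The weight is continuous on the compact support, where the distance is positive. Both absorption
arguments rely on this finiteness. -/
theorem MemLipZero.lintegral_mul_rpow_infDist_ne_top {X : Type*} [MetricSpace X]
    [MeasurableSpace X] [BorelSpace X] {μ : Measure X} [IsFiniteMeasureOnCompacts μ] {Ω : Set X} (hΩ : IsOpen Ω)
    (hne : Ωᶜ.Nonempty) {v : X → ℝ} (hv : MemLipZero Ω v) (a : ℝ) :
    ∫⁻ x, ‖v x‖ₑ * ENNReal.ofReal (Metric.infDist x Ωᶜ ^ a) ∂μ ≠ ⊤ := by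
  obtain ⟨⟨L, hL⟩, hc, hs⟩ := hv
  have hpos : ∀ x ∈ tsupport v, 0 < Metric.infDist x Ωᶜ := fun x hx =>
    (hΩ.isClosed_compl.notMem_iff_infDist_pos hne).1 (fun h => h (hs hx))
  have hcont : ContinuousOn (fun x => v x * Metric.infDist x Ωᶜ ^ a) (tsupport v) :=
    hL.continuous.continuousOn.mul ((Metric.continuous_infDist_pt _).continuousOn.rpow_const
      fun x hx => Or.inl (hpos x hx).ne')
  have hint := hcont.integrableOn_compact (μ := μ) hc
  have hfin := hint.2
  rw [HasFiniteIntegral, ← lintegral_indicator (isClosed_tsupport v).measurableSet] at hfin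
  refine ne_of_lt (lt_of_le_of_lt (lintegral_mono fun x => ?_) hfin)
  by_cases hx : x ∈ tsupport v
  · rw [Set.indicator_of_mem hx, enorm_mul, Real.enorm_of_nonneg (Real.rpow_nonneg
      Metric.infDist_nonneg _)]
  · simp [image_eq_zero_of_notMem_tsupport hx]

/-- On E a negative power of the distance is ⊤ in one convention and 0 in the other; the vanishing
factor c hides the discrepancy. -/
theorem mul_infEDist_rpow_eq {X : Type*} [PseudoMetricSpace X] {E : Set X} (hE : IsClosed E) (hne : E.Nonempty) {x : X} {c : ℝ≥0∞}
    (hc : x ∈ E → c = 0) (a : ℝ) :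
    c * Metric.infEDist x E ^ a = c * ENNReal.ofReal (Metric.infDist x E ^ a) := by
  by_cases hx : x ∈ E
  · simp [hc hx]
  · have h := (hE.notMem_iff_infDist_pos hne).1 hx
    rw [← ENNReal.ofReal_rpow_of_pos h, Metric.infDist,
      ENNReal.ofReal_toReal (Metric.infEDist_ne_top hne)]

section

variable {X : Type*} [NormedAddCommGroup X] [InnerProductSpace ℝ X] [FiniteDimensional ℝ X]

theorem enorm_gradient_abs_rpow {u : X → ℝ} {x : X} (hu : DifferentiableAt ℝ u x) {p : ℝ}
    (hp : 1 < p) :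
    ‖gradient (fun x => |u x| ^ p) x‖ₑ =
      ENNReal.ofReal p * (‖u x‖ₑ ^ (p - 1) * ‖gradient u x‖ₑ) := by
  have h := (hasDerivAt_abs_rpow (u x) hp).comp_hasFDerivAt x hu.hasFDerivAt
  have h' : fderiv ℝ (fun x => |u x| ^ p) x = (p * |u x| ^ (p - 2) * u x) • fderiv ℝ u x := h.fderiv
  have hg : gradient (fun x => |u x| ^ p) x = (p * |u x| ^ (p - 2) * u x) • gradient u x := by
    unfold gradient; rw [h', map_smul]
  rw [hg, enorm_smul, ← mul_assoc]
  congr 1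
  rw [← ofReal_norm, ← ofReal_norm, ENNReal.ofReal_rpow_of_nonneg (norm_nonneg _) (by linarith),
    ← ENNReal.ofReal_mul (by linarith)]
  congr 1
  rw [norm_mul, norm_mul, Real.norm_of_nonneg (by linarith : 0 ≤ p),
    Real.norm_of_nonneg (Real.rpow_nonneg (abs_nonneg _) _), Real.norm_eq_abs, mul_assoc]
  congr 1
  rcases eq_or_ne (u x) 0 with h0 | h0
  · simp [h0, Real.zero_rpow (by linarith : p - 1 ≠ 0)]
  · rw [← Real.rpow_add_one (abs_pos.2 h0).ne', show p - 2 + 1 = p - 1 by ring]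

theorem gradient_eq_zero_of_notMem_tsupport {u : X → ℝ} {x : X} (hx : x ∉ tsupport u) :
    gradient u x = 0 := by
  have : fderiv ℝ u x = 0 := by
    by_contra h
    exact hx (tsupport_fderiv_subset ℝ (subset_closure h))
  simp [gradient, this]

variable [MeasurableSpace X] [BorelSpace X] {μ : Measure X} [μ.IsAddHaarMeasure]

/-- The `L¹` Hardy inequality with weights `d ^ (-q)` and `d ^ (1 - q)` implies the `Lᵖ` one with
weights `d ^ (-q)` and `d ^ (p - q)`. -/
theorem hardy_of_hardy_one {Ω : Set X} (hΩ : IsOpen Ω) (hne : Ωᶜ.Nonempty) {p q : ℝ} (hp : 1 < p)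
    {C : ℝ≥0∞} (hC : ∀ v : X → ℝ, MemLipZero Ω v →
      ∫⁻ x, ‖v x‖ₑ * Metric.infEDist x Ωᶜ ^ (-q) ∂μ ≤
        C * ∫⁻ x, ‖gradient v x‖ₑ * Metric.infEDist x Ωᶜ ^ (1 - q) ∂μ)
    {u : X → ℝ} (hu : MemLipZero Ω u) :
    ∫⁻ x in Ω, ‖u x‖ₑ ^ p * Metric.infEDist x Ωᶜ ^ (-q) ∂μ ≤
      (C * ENNReal.ofReal p) ^ p *
        ∫⁻ x in Ω, ‖gradient u x‖ₑ ^ p * Metric.infEDist x Ωᶜ ^ (p - q) ∂μ := by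
  have hp0 : 0 < p := by linarith
  have hE := hΩ.isClosed_compl
  have hpq : p.HolderConjugate (p.conjExponent) := Real.HolderConjugate.conjExponent hp
  have hdm : Measurable fun x => Metric.infEDist x Ωᶜ :=
    (Metric.continuous_infEDist).measurable
  have hu0 : ∀ x, x ∉ Ω → u x = 0 := fun x hx =>
    image_eq_zero_of_notMem_tsupport fun h => hx (hu.2.2 h)
  have hg0 : ∀ x, x ∉ Ω → gradient u x = 0 := fun x hx =>
    gradient_eq_zero_of_notMem_tsupport fun h => hx (hu.2.2 h)
  have huc : Continuous u := hu.1.choose_spec.continuous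
  have hv := hu.abs_rpow hp
  have hve : ∀ x, ‖|u x| ^ p‖ₑ = ‖u x‖ₑ ^ p := fun x => by
    rw [Real.enorm_rpow_of_nonneg (abs_nonneg _) hp0.le]
    simp
  have hfin := hv.lintegral_mul_rpow_infDist_ne_top hΩ hne (μ := μ) (-q)
  have hA : ∫⁻ x, ‖|u x| ^ p‖ₑ * Metric.infEDist x Ωᶜ ^ (-q) ∂μ =
      ∫⁻ x, ‖|u x| ^ p‖ₑ * ENNReal.ofReal (Metric.infDist x Ωᶜ ^ (-q)) ∂μ := by
    refine lintegral_congr fun x => mul_infEDist_rpow_eq hE hne (fun hx => ?_) _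
    simp [hu0 x hx, hp0.ne']
  rw [← hA] at hfin
  have h1 := hC _ hv
  simp only [hve] at hfin h1
  set A := ∫⁻ x, ‖u x‖ₑ ^ p * Metric.infEDist x Ωᶜ ^ (-q) ∂μ
  have hB : ∫⁻ x in Ω, ‖gradient u x‖ₑ ^ p * Metric.infEDist x Ωᶜ ^ (p - q) ∂μ =
      ∫⁻ x, ‖gradient u x‖ₑ ^ p * Metric.infEDist x Ωᶜ ^ (p - q) ∂μ := by
    rw [← lintegral_indicator hΩ.measurableSet]
    refine lintegral_congr fun x => ?_
    by_cases hx : x ∈ Ω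
    · rw [Set.indicator_of_mem hx]
    · rw [Set.indicator_of_notMem hx, hg0 x hx]
      simp [hp0]
  refine (setLIntegral_le_lintegral _ _).trans ?_
  rw [hB]
  refine ENNReal.le_rpow_mul_of_le_mul_rpow hfin hpq (h1.trans ?_)
  rw [mul_assoc]
  gcongr
  -- The weight d^(1-q) is split so that the conjugate power of f is |u|^p d^(-q) and the p-th power
  -- of g is |∇u|^p d^(p-q).
  set f : X → ℝ≥0∞ := fun x => ‖u x‖ₑ ^ (p - 1) * Metric.infEDist x Ωᶜ ^ (-q * (p - 1) / p)
  set g : X → ℝ≥0∞ := fun x => ‖gradient u x‖ₑ * Metric.infEDist x Ωᶜ ^ ((p - q) / p)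
  have hfm : Measurable f := (huc.measurable.enorm.pow_const _).mul (hdm.pow_const _)
  have hgm : Measurable g := (measurable_gradient u).enorm.mul (hdm.pow_const _)
  have hfg : ∫⁻ x, ‖gradient (fun x => |u x| ^ p) x‖ₑ * Metric.infEDist x Ωᶜ ^ (1 - q) ∂μ =
      ENNReal.ofReal p * ∫⁻ x, (f * g) x ∂μ := by
    rw [← lintegral_const_mul' _ _ ENNReal.ofReal_ne_top]
    refine lintegral_congr_ae ?_
    filter_upwards [hu.1.choose_spec.ae_differentiableAt (μ := μ)] with x hx
    rw [enorm_gradient_abs_rpow hx hp]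
    by_cases hxΩ : x ∈ Ω
    · have hd0 : Metric.infEDist x Ωᶜ ≠ 0 := by
        intro h
        exact (Metric.mem_iff_infEDist_zero_of_closed hE).2 h hxΩ
      have e : (1 - q) = -q * (p - 1) / p + (p - q) / p := by field_simp; ring
      rw [e, ENNReal.rpow_add _ _ hd0 (Metric.infEDist_ne_top hne)]
      simp only [f, g, Pi.mul_apply]
      ring
    · simp [f, g, hg0 x hxΩ]
  rw [hfg]
  gcongr
  have hold := ENNReal.lintegral_mul_le_Lp_mul_Lq μ hpq.symm hfm.aemeasurable hgm.aemeasurable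
  refine hold.trans (le_of_eq ?_)
  have hr : 0 ≤ p.conjExponent := hpq.symm.pos.le
  have hr' : (p - 1) * p.conjExponent = p := by
    rw [Real.conjExponent, mul_div_cancel₀ _ (by linarith)]
  congr 2
  · refine lintegral_congr fun x => ?_
    simp only [f]
    rw [ENNReal.mul_rpow_of_nonneg _ _ hr, ← ENNReal.rpow_mul, ← ENNReal.rpow_mul, hr']
    congr 2
    rw [div_mul_eq_mul_div, mul_assoc, hr', mul_div_cancel_right₀ _ hp0.ne']
  · refine lintegral_congr fun x => ?_
    simp only [g]
    rw [ENNReal.mul_rpow_of_nonneg _ _ hp0.le, ← ENNReal.rpow_mul, div_mul_cancel₀ _ hp0.ne']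

end

/-! ### The L¹ Hardy inequality from volume bounds -/

section Hardy

variable {X : Type*} [NormedAddCommGroup X] [InnerProductSpace ℝ X] [FiniteDimensional ℝ X]
  [MeasurableSpace X] [BorelSpace X] {μ : Measure X} [μ.IsAddHaarMeasure]

/-- The `L¹` Hardy inequality from uniform bounds, at all scales `R`, for the volume of the parts
of balls of radius `ρ R` that are close to the complement. -/
theorem hardy_one_of_volume_bounds {Ω : Set X} (hΩ : IsOpen Ω) (hne : Ωᶜ.Nonempty)
    {q ρ τ m M : ℝ} (hq : 1 < q) (hρ : 0 < ρ) (hτ : 0 < τ) (hm0 : 0 < m) (hM0 : 0 ≤ M)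
    (hm : ∀ R : ℝ, 0 < R → ∀ x, Metric.infDist x Ωᶜ < R →
      ENNReal.ofReal (m * R ^ Module.finrank ℝ X) ≤
        μ (Metric.ball x (ρ * R) ∩ {y | Metric.infDist y Ωᶜ < τ * R}))
    (hM : ∀ R : ℝ, 0 < R → ∀ y, μ (Metric.ball y (ρ * R) ∩ {x | Metric.infDist x Ωᶜ < R}) ≤
      ENNReal.ofReal (M * R ^ Module.finrank ℝ X))
    (hA : M / m * τ ^ q ≤ 1 / 2) :
    ∃ C : ℝ≥0, ∀ v : X → ℝ, MemLipZero Ω v →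
      ∫⁻ x, ‖v x‖ₑ * Metric.infEDist x Ωᶜ ^ (-q) ∂μ ≤
        C * ∫⁻ x, ‖gradient v x‖ₑ * Metric.infEDist x Ωᶜ ^ (1 - q) ∂μ := by
  set n := Module.finrank ℝ X
  have hE := hΩ.isClosed_compl
  set d : X → ℝ := fun x => Metric.infDist x Ωᶜ
  have hdL : LipschitzWith 1 d := Metric.lipschitz_infDist_pt _
  set b : ℝ := (μ (Metric.ball (0 : X) 1)).toReal
  have hb : 0 < b := ENNReal.toReal_pos (Metric.measure_ball_pos μ _ one_pos).ne'
    measure_ball_lt_top.ne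
  -- The gradient term carries the volume of a ball of radius ρR times ρR; divided by m R^n this is
  -- B R.
  set B : ℝ := b * ρ ^ n * ρ / m
  have hB : 0 < B := by positivity
  refine ⟨Real.toNNReal (2 * q * B * ((1 + ρ) ^ (q - 1) / (q - 1))), fun v hv => ?_⟩
  have hzero : ∀ x, d x ≤ 0 → x ∉ tsupport v := fun x hx h => by
    have h1 : x ∉ Ωᶜ := fun h' => h' (hv.2.2 h)
    exact absurd ((hE.notMem_iff_infDist_pos hne).1 h1) (not_lt.2 hx)
  have hd0 : ∀ x, x ∈ Ωᶜ → d x ≤ 0 := fun x hx => (Metric.infDist_zero_of_mem hx).le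
  have hvd : ∀ x, d x ≤ 0 → ‖v x‖ₑ = 0 := fun x hx => by
    simp [image_eq_zero_of_notMem_tsupport (hzero x hx)]
  have hgd : ∀ x, d x ≤ 0 → ‖gradient v x‖ₑ = 0 := fun x hx => by
    simp [gradient_eq_zero_of_notMem_tsupport (hzero x hx)]
  simp_rw [mul_infEDist_rpow_eq hE hne (fun hx => hvd _ (hd0 _ hx)),
    mul_infEDist_rpow_eq hE hne (fun hx => hgd _ (hd0 _ hx))]
  have hfin := hv.lintegral_mul_rpow_infDist_ne_top hΩ hne (μ := μ) (-q)
  obtain ⟨L, hL⟩ := hv.1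
  refine lintegral_mul_rpow_le_of_sublevel hL.continuous.measurable.enorm
    (measurable_gradient v).enorm hdL.continuous.measurable hvd hgd hq hτ
    (div_nonneg hM0 hm0.le) hB (by linarith) hA (fun R hR => ?_) hfin
  have key := lintegral_sublevel_le (μ := μ) hL hdL (R := R) (S := τ * R) (ρ := ρ * R)
    ENNReal.ofReal_ne_top (hm R hR) (hM R hR)
  have hbd : μ (Metric.ball (0 : X) (ρ * R)) = ENNReal.ofReal (b * (ρ * R) ^ n) := by
    rw [Measure.addHaar_ball_of_pos μ _ (by positivity), ENNReal.ofReal_mul hb.le,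
      ENNReal.ofReal_toReal measure_ball_lt_top.ne, mul_comm]
  have hmR : 0 < m * R ^ n := by positivity
  have hmR' : ENNReal.ofReal (m * R ^ n) ≠ 0 := (ENNReal.ofReal_pos.2 hmR).ne'
  rw [← ENNReal.mul_le_mul_iff_right hmR' ENNReal.ofReal_ne_top]
  refine key.trans (le_of_eq ?_)
  rw [hbd, mul_add, ← mul_assoc, ← mul_assoc, ← mul_assoc, ← ENNReal.ofReal_mul (by positivity),
    ← ENNReal.ofReal_mul (by positivity), ← ENNReal.ofReal_mul (by positivity),
    show R + ρ * R = (1 + ρ) * R by ring]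
  congr 3
  · field_simp
  · simp only [B, mul_pow]
    field_simp

end Hardy

/-! ### Upper Assouad exponents and volumes of neighbourhoods -/

section Upper

/-- An upper Assouad exponent bounds covering numbers at all scales, also beyond the diameter. -/
theorem IsUpperAssouadExponent.exists_cover {X : Type*} [MetricSpace X] [ProperSpace X]
    {E : Set X} {s : ℝ} (h : IsUpperAssouadExponent E s) :
    ∃ C : ℝ, 0 < C ∧ ∀ x ∈ E, ∀ r R : ℝ, 0 < r → r < R →
      ∃ F : Finset X, E ∩ Metric.closedBall x R ⊆ ⋃ y ∈ F, Metric.closedBall y r ∧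
        (F.card : ℝ) ≤ C * (r / R) ^ (-s) := by
  classical
  obtain ⟨hs, C, hC, hcov⟩ := h
  have hone : ∀ r R : ℝ, 0 < r → r < R → 1 ≤ (r / R) ^ (-s) := fun r R hr hrR =>
    Real.one_le_rpow_of_pos_of_le_one_of_nonpos (div_pos hr (hr.trans hrR))
      ((div_le_one (hr.trans hrR)).2 hrR.le) (by linarith)
  by_cases hbd : Bornology.IsBounded E
  swap
  · refine ⟨C, by linarith, fun x hx r R hr hrR => hcov x hx r R hr hrR ?_⟩
    rw [Metric.isBounded_iff_ediam_ne_top, not_not] at hbd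
    rw [hbd]; exact ENNReal.ofReal_lt_top
  by_cases hsub : E.Subsingleton
  · refine ⟨1, one_pos, fun x hx r R hr hrR => ⟨{x}, ?_, ?_⟩⟩
    · intro y hy
      rw [hsub hy.1 hx]
      simp [hr.le]
    · simpa using hone r R hr hrR
  have hD0 : 0 < Metric.diam E := by
    rw [Set.not_subsingleton_iff] at hsub
    exact Metric.diam_pos hsub hbd
  set D := Metric.diam E
  have hDe : Metric.ediam E = ENNReal.ofReal D :=
    (ENNReal.ofReal_toReal (Metric.isBounded_iff_ediam_ne_top.1 hbd)).symm
  -- For R ≥ D, cover all of E by the finitely many D/2-balls around T. If r < D/2, each is refined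
  -- by the hypothesis, as D/2 < D; otherwise T itself serves.
  obtain ⟨T, hTE, hTf, hT⟩ := exists_finite_cover_balls_of_isCompact_closure
    hbd.isCompact_closure (by positivity : 0 < D / 2)
  lift T to Finset X using hTf
  refine ⟨C * (T.card + 1), by positivity, fun x hx r R hr hrR => ?_⟩
  rcases lt_or_ge R D with hRD | hRD
  · obtain ⟨F, hF, hFc⟩ := hcov x hx r R hr hrR (by rwa [hDe, ENNReal.ofReal_lt_ofReal_iff hD0])
    refine ⟨F, hF, hFc.trans ?_⟩
    refine mul_le_mul_of_nonneg_right ?_ (by linarith [hone r R hr hrR])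
    nlinarith [(Nat.cast_nonneg T.card : (0 : ℝ) ≤ T.card)]
  rcases lt_or_ge r (D / 2) with hrD | hrD
  · have hF : ∀ z ∈ T, ∃ F : Finset X,
        E ∩ Metric.closedBall z (D / 2) ⊆ ⋃ y ∈ F, Metric.closedBall y r ∧
          (F.card : ℝ) ≤ C * (r / (D / 2)) ^ (-s) := fun z hz =>
      hcov z (hTE hz) r (D / 2) hr hrD (by
        rw [hDe, ENNReal.ofReal_lt_ofReal_iff hD0]; linarith)
    choose! F hF hFc using hF
    refine ⟨T.biUnion F, ?_, ?_⟩
    · intro y hy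
      obtain ⟨z, hz, hyz⟩ := Set.mem_iUnion₂.1 (hT hy.1)
      obtain ⟨w, hw, hyw⟩ := Set.mem_iUnion₂.1 (hF z hz ⟨hy.1, Metric.ball_subset_closedBall hyz⟩)
      exact Set.mem_iUnion₂.2 ⟨w, Finset.mem_biUnion.2 ⟨z, hz, hw⟩, hyw⟩
    · have hle : (r / (D / 2)) ^ (-s) ≤ (r / R) ^ (-s) := by
        refine Real.rpow_le_rpow_of_nonpos (div_pos hr (hr.trans hrR)) ?_ (by linarith)
        exact div_le_div_of_nonneg_left hr.le (by linarith) (by linarith)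
      calc ((T.biUnion F).card : ℝ) ≤ ∑ z ∈ T, ((F z).card : ℝ) := by
            exact_mod_cast Finset.card_biUnion_le
        _ ≤ ∑ _z ∈ T, C * (r / R) ^ (-s) := by
            refine Finset.sum_le_sum fun z hz => (hFc z hz).trans ?_
            gcongr
        _ = C * T.card * (r / R) ^ (-s) := by rw [Finset.sum_const, nsmul_eq_mul]; ring
        _ ≤ _ := by
            refine mul_le_mul_of_nonneg_right ?_ (by linarith [hone r R hr hrR])
            nlinarith
  · refine ⟨T, ?_, ?_⟩
    · intro y hy
      obtain ⟨z, hz, hyz⟩ := Set.mem_iUnion₂.1 (hT hy.1)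
      exact Set.mem_iUnion₂.2 ⟨z, hz,
        Metric.closedBall_subset_closedBall hrD (Metric.ball_subset_closedBall hyz)⟩
    · have h1 := hone r R hr hrR
      have h2 : (T.card : ℝ) ≤ C * (T.card + 1) := by
        nlinarith [(Nat.cast_nonneg T.card : (0 : ℝ) ≤ T.card)]
      nlinarith

variable {X : Type*} [NormedAddCommGroup X] [NormedSpace ℝ X] [FiniteDimensional ℝ X]
  [MeasurableSpace X] [BorelSpace X] {μ : Measure X} [μ.IsAddHaarMeasure]

/-- About K^s balls of radius R cover the relevant part of E; doubling their radii covers its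
R-neighbourhood. -/
theorem IsUpperAssouadExponent.exists_volume_le {E : Set X} {s : ℝ}
    (h : IsUpperAssouadExponent E s) (hne : E.Nonempty) :
    ∃ C : ℝ, 0 < C ∧ ∀ K : ℝ, 1 ≤ K → ∀ R : ℝ, 0 < R → ∀ y,
      μ (Metric.ball y (K * R) ∩ {x | Metric.infDist x E < R}) ≤
        ENNReal.ofReal (C * K ^ s * R ^ Module.finrank ℝ X) := by
  obtain ⟨C, hC, hcov⟩ := h.exists_cover
  have hs := h.1
  set n := Module.finrank ℝ X
  set b : ℝ := (μ (Metric.ball (0 : X) 1)).toReal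
  have hb : 0 < b := ENNReal.toReal_pos (Metric.measure_ball_pos μ _ one_pos).ne'
    measure_ball_lt_top.ne
  refine ⟨C * 4 ^ s * b * 2 ^ n, by positivity, fun K hK R hR y => ?_⟩
  rcases (Metric.ball y (K * R) ∩ {x | Metric.infDist x E < R}).eq_empty_or_nonempty with h0 | h0
  · simp [h0]
  obtain ⟨x₀, hx₀, hx₀'⟩ := h0
  obtain ⟨w, hw, hxw⟩ := (Metric.infDist_lt_iff hne).1 hx₀'
  have hKR : R ≤ K * R := le_mul_of_one_le_left hR.le hK
  -- A point of E within R of the set is within R + KR + KR + R ≤ 4KR of w.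
  obtain ⟨F, hF, hFc⟩ := hcov w hw R (4 * K * R) hR (by linarith)
  have hsub : Metric.ball y (K * R) ∩ {x | Metric.infDist x E < R} ⊆
      ⋃ z ∈ F, Metric.closedBall z (2 * R) := by
    rintro x ⟨hx, hx'⟩
    obtain ⟨e, he, hxe⟩ := (Metric.infDist_lt_iff hne).1 hx'
    rw [Metric.mem_ball] at hx hx₀
    have hew : dist e w ≤ 4 * K * R := by
      have h1 := dist_triangle4 e x y x₀
      have h2 := dist_triangle e x₀ w
      rw [dist_comm e x, dist_comm y x₀] at h1
      linarith
    obtain ⟨z, hz, hez⟩ := Set.mem_iUnion₂.1 (hF ⟨he, hew⟩)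
    refine Set.mem_iUnion₂.2 ⟨z, hz, ?_⟩
    rw [Metric.mem_closedBall] at hez ⊢
    linarith [dist_triangle x e z]
  calc μ (Metric.ball y (K * R) ∩ {x | Metric.infDist x E < R})
      ≤ ∑ z ∈ F, μ (Metric.closedBall z (2 * R)) :=
        (measure_mono hsub).trans (measure_biUnion_finset_le _ _)
    _ = ENNReal.ofReal (F.card * ((2 * R) ^ n * b)) := by
        rw [Finset.sum_congr rfl fun z _ => Measure.addHaar_closedBall μ z
          (by positivity : 0 ≤ 2 * R), Finset.sum_const, nsmul_eq_mul,
          ENNReal.ofReal_mul (by positivity), ENNReal.ofReal_natCast,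
          ENNReal.ofReal_mul (by positivity), ENNReal.ofReal_toReal measure_ball_lt_top.ne]
    _ ≤ _ := by
        refine ENNReal.ofReal_le_ofReal ?_
        have e : (R / (4 * K * R)) ^ (-s) = 4 ^ s * K ^ s := by
          rw [← Real.mul_rpow (by norm_num) (by linarith), Real.rpow_neg (by positivity),
            ← Real.inv_rpow (by positivity)]
          congr 1
          field_simp
        rw [e] at hFc
        calc (F.card : ℝ) * ((2 * R) ^ n * b) ≤ C * (4 ^ s * K ^ s) * ((2 * R) ^ n * b) := by
              gcongr
          _ = _ := by rw [mul_pow]; ring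

end Upper

/-! ### Lower Assouad exponents and volumes of neighbourhoods -/

section Lower

/-- Vitali selects disjoint balls of radius r/8 from a finite cover; their fourfold enlargements, of
radius r/2, still cover, so the covering bound counts them. Unboundedness of E admits every R. -/
theorem IsLowerAssouadExponent.exists_disjoint_closedBalls {X : Type*} [MetricSpace X]
    [ProperSpace X] {E : Set X} (hE : IsClosed E) {t : ℝ} (h : IsLowerAssouadExponent E t)
    (hunb : Metric.ediam E = ⊤) :
    ∃ c : ℝ, 0 < c ∧ ∀ w ∈ E, ∀ r R : ℝ, 0 < r → r < R → ∃ F : Finset X,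
      (∀ z ∈ F, z ∈ E ∩ Metric.closedBall w R) ∧
      (F : Set X).PairwiseDisjoint (fun z => Metric.closedBall z (r / 8)) ∧
      c * (r / R) ^ (-t) ≤ F.card := by
  obtain ⟨-, c, hc, hcov⟩ := h
  refine ⟨c, hc, fun w hw r R hr hrR => ?_⟩
  have hcomp : IsCompact (E ∩ Metric.closedBall w R) :=
    (isCompact_closedBall w R).inter_left hE
  obtain ⟨T, hTE, hTf, hT⟩ := hcomp.finite_cover_balls (by positivity : 0 < r / 8)
  obtain ⟨u, huT, hdisj, hu⟩ := Vitali.exists_disjoint_subfamily_covering_enlargement_closedBall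
    T (fun z => z) (fun _ => r / 8) (r / 8) (fun _ _ => le_rfl) 4 (by norm_num)
  have huf := hTf.subset huT
  lift u to Finset X using huf
  refine ⟨u, fun z hz => hTE (huT hz), hdisj, ?_⟩
  refine hcov w hw r R hr hrR (by simp [hunb]) u fun x hx => ?_
  obtain ⟨z, hz, hxz⟩ := Set.mem_iUnion₂.1 (hT hx)
  obtain ⟨y, hy, hzy⟩ := hu z hz
  refine Set.mem_iUnion₂.2 ⟨y, hy, ?_⟩
  exact Metric.closedBall_subset_closedBall (by linarith)
    (hzy (Metric.ball_subset_closedBall hxz))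

variable {X : Type*} [NormedAddCommGroup X] [NormedSpace ℝ X] [FiniteDimensional ℝ X]
  [MeasurableSpace X] [BorelSpace X] {μ : Measure X} [μ.IsAddHaarMeasure]

/-- At least c l^(-t) disjoint balls of radius lR/8 centred on E fit in the set, each of volume
comparable to (lR)^n. They stay in B(x, 3R) since lR/8 + R + R < 3R. -/
theorem IsLowerAssouadExponent.exists_le_volume {E : Set X} (hE : IsClosed E) (hne : E.Nonempty)
    {t : ℝ} (h : IsLowerAssouadExponent E t) (hunb : Metric.ediam E = ⊤) :
    ∃ c : ℝ, 0 < c ∧ ∀ l : ℝ, 0 < l → l < 1 → ∀ R : ℝ, 0 < R → ∀ x, Metric.infDist x E < R →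
      ENNReal.ofReal (c * l ^ ((Module.finrank ℝ X : ℝ) - t) * R ^ Module.finrank ℝ X) ≤
        μ (Metric.ball x (3 * R) ∩ {y | Metric.infDist y E < l * R}) := by
  obtain ⟨c, hc, hdis⟩ := h.exists_disjoint_closedBalls hE hunb
  set n := Module.finrank ℝ X
  set b : ℝ := (μ (Metric.ball (0 : X) 1)).toReal
  have hb : 0 < b := ENNReal.toReal_pos (Metric.measure_ball_pos μ _ one_pos).ne'
    measure_ball_lt_top.ne
  refine ⟨c * b / 8 ^ n, by positivity, fun l hl hl1 R hR x hx => ?_⟩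
  obtain ⟨w, hw, hxw⟩ := (Metric.infDist_lt_iff hne).1 hx
  have hlR : l * R < R := mul_lt_of_lt_one_left hR hl1
  have hlR0 : 0 < l * R := by positivity
  obtain ⟨F, hF, hdisj, hFc⟩ := hdis w hw (l * R) R hlR0 hlR
  have hsub : (⋃ z ∈ F, Metric.closedBall z (l * R / 8)) ⊆
      Metric.ball x (3 * R) ∩ {y | Metric.infDist y E < l * R} := by
    intro y hy
    obtain ⟨z, hz, hyz⟩ := Set.mem_iUnion₂.1 hy
    obtain ⟨hzE, hzw⟩ := hF z hz
    rw [Metric.mem_closedBall] at hyz hzw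
    refine ⟨?_, ?_⟩
    · rw [Metric.mem_ball]
      have := dist_triangle4 y z w x
      rw [dist_comm w x] at this
      linarith
    · exact (Metric.infDist_le_dist_of_mem hzE).trans_lt (by linarith)
  calc _ ≤ ENNReal.ofReal (F.card * ((l * R / 8) ^ n * b)) := by
        refine ENNReal.ofReal_le_ofReal ?_
        have e : (l * R / R) ^ (-t) * l ^ n = l ^ ((n : ℝ) - t) := by
          rw [mul_div_cancel_right₀ _ hR.ne', ← Real.rpow_natCast, ← Real.rpow_add hl]
          congr 1; ring
        calc _ = c * (l * R / R) ^ (-t) * ((l * R / 8) ^ n * b) := by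
              rw [← e, div_pow, mul_pow]; ring
          _ ≤ _ := by gcongr
    _ = ∑ z ∈ F, μ (Metric.closedBall z (l * R / 8)) := by
        rw [Finset.sum_congr rfl fun z _ => Measure.addHaar_closedBall μ z
          (by positivity : 0 ≤ l * R / 8), Finset.sum_const, nsmul_eq_mul,
          ENNReal.ofReal_mul (by positivity), ENNReal.ofReal_natCast,
          ENNReal.ofReal_mul (by positivity), ENNReal.ofReal_toReal measure_ball_lt_top.ne]
    _ = μ (⋃ z ∈ F, Metric.closedBall z (l * R / 8)) :=
        (measure_biUnion_finset hdisj fun z _ => Metric.isClosed_closedBall.measurableSet).symm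
    _ ≤ _ := measure_mono hsub

end Lower

/-! ### Choice of scales in the two dimension regimes -/

section

variable {X : Type*} [NormedAddCommGroup X] [InnerProductSpace ℝ X] [FiniteDimensional ℝ X]
  [MeasurableSpace X] [BorelSpace X] {μ : Measure X} [μ.IsAddHaarMeasure]

/-- If d x < R, the whole ball B(x, KR) lies in {d < (K + 1) R}, so m = b K^n, against M = C K^s.
The product to be made small is of order K^(s+q-n), with negative exponent. -/
theorem IsUpperAssouadExponent.hardy_one {Ω : Set X} (hΩ : IsOpen Ω) (hne : Ωᶜ.Nonempty)
    {q s : ℝ} (hq : 1 < q) (h : IsUpperAssouadExponent Ωᶜ s)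
    (hs : s < Module.finrank ℝ X - q) :
    ∃ C : ℝ≥0, ∀ v : X → ℝ, MemLipZero Ω v →
      ∫⁻ x, ‖v x‖ₑ * Metric.infEDist x Ωᶜ ^ (-q) ∂μ ≤
        C * ∫⁻ x, ‖gradient v x‖ₑ * Metric.infEDist x Ωᶜ ^ (1 - q) ∂μ := by
  obtain ⟨C, hC, hvol⟩ := h.exists_volume_le (μ := μ) hne
  set n := Module.finrank ℝ X
  set b : ℝ := (μ (Metric.ball (0 : X) 1)).toReal
  have hb : 0 < b := ENNReal.toReal_pos (Metric.measure_ball_pos μ _ one_pos).ne'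
    measure_ball_lt_top.ne
  have hlim : Filter.Tendsto (fun K : ℝ => C * 2 ^ q / b * K ^ (-(n - q - s))) Filter.atTop
      (nhds (C * 2 ^ q / b * 0)) :=
    (tendsto_rpow_neg_atTop (by linarith)).const_mul _
  rw [mul_zero] at hlim
  obtain ⟨K, hK, hK1⟩ := ((hlim.eventually_le_const (by norm_num : (0 : ℝ) < 1 / 2)).and
    (Filter.eventually_ge_atTop 1)).exists
  have hK0 : 0 < K := by linarith
  refine hardy_one_of_volume_bounds hΩ hne (ρ := K) (τ := K + 1) (m := b * K ^ n)
    (M := C * K ^ s) hq hK0 (by linarith) (by positivity) (by positivity) ?_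
    (fun R hR y => hvol K hK1 R hR y) ?_
  · intro R hR x hx
    rw [Set.inter_eq_left.2]
    · rw [Measure.addHaar_ball_of_pos μ _ (by positivity), mul_assoc, ← mul_pow,
        ENNReal.ofReal_mul hb.le, ENNReal.ofReal_toReal measure_ball_lt_top.ne, mul_comm]
    · intro y hy
      rw [Metric.mem_ball] at hy
      have := Metric.infDist_le_infDist_add_dist (s := Ωᶜ) (x := y) (y := x)
      show Metric.infDist y Ωᶜ < (K + 1) * R
      linarith
  · refine le_trans ?_ hK
    have h1 : (K + 1) ^ q ≤ 2 ^ q * K ^ q := by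
      rw [← Real.mul_rpow (by norm_num) hK0.le]
      exact Real.rpow_le_rpow (by linarith) (by linarith) (by linarith)
    calc C * K ^ s / (b * K ^ n) * (K + 1) ^ q ≤ C * K ^ s / (b * K ^ n) * (2 ^ q * K ^ q) := by
          gcongr
      _ = C * 2 ^ q / b * (K ^ s * K ^ q / K ^ (n : ℝ)) := by
          rw [Real.rpow_natCast]; field_simp
      _ = _ := by
          rw [← Real.rpow_add hK0, ← Real.rpow_sub hK0]
          congr 2; ring

/-- Here the radius 3R is fixed and τ = 1/K shrinks: M is the full ball volume, m is of order
K^(t-n), and the product is of order K^(n-q-t), again with negative exponent. -/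
theorem IsLowerAssouadExponent.hardy_one {Ω : Set X} (hΩ : IsOpen Ω) (hne : Ωᶜ.Nonempty)
    (hunb : Metric.ediam Ωᶜ = ⊤) {q t : ℝ} (hq : 1 < q) (h : IsLowerAssouadExponent Ωᶜ t)
    (ht : Module.finrank ℝ X - q < t) :
    ∃ C : ℝ≥0, ∀ v : X → ℝ, MemLipZero Ω v →
      ∫⁻ x, ‖v x‖ₑ * Metric.infEDist x Ωᶜ ^ (-q) ∂μ ≤
        C * ∫⁻ x, ‖gradient v x‖ₑ * Metric.infEDist x Ωᶜ ^ (1 - q) ∂μ := by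
  obtain ⟨c, hc, hvol⟩ := h.exists_le_volume (μ := μ) hΩ.isClosed_compl hne hunb
  set n := Module.finrank ℝ X
  set b : ℝ := (μ (Metric.ball (0 : X) 1)).toReal
  have hb : 0 < b := ENNReal.toReal_pos (Metric.measure_ball_pos μ _ one_pos).ne'
    measure_ball_lt_top.ne
  have hlim : Filter.Tendsto (fun K : ℝ => b * 3 ^ n / c * K ^ (-(t - (n - q)))) Filter.atTop
      (nhds (b * 3 ^ n / c * 0)) :=
    (tendsto_rpow_neg_atTop (by linarith)).const_mul _
  rw [mul_zero] at hlim
  obtain ⟨K, hK, hK1⟩ := ((hlim.eventually_le_const (by norm_num : (0 : ℝ) < 1 / 2)).and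
    (Filter.eventually_gt_atTop 1)).exists
  have hK0 : 0 < K := by linarith
  have hl0 : 0 < K⁻¹ := inv_pos.2 hK0
  refine hardy_one_of_volume_bounds hΩ hne (ρ := 3) (τ := K⁻¹)
    (m := c * K⁻¹ ^ ((n : ℝ) - t)) (M := b * 3 ^ n) hq (by norm_num) hl0 (by positivity)
    (by positivity) (fun R hR x hx => hvol K⁻¹ hl0 (inv_lt_one_of_one_lt₀ hK1) R hR x hx) ?_ ?_
  · intro R hR y
    refine (measure_mono Set.inter_subset_left).trans (le_of_eq ?_)
    rw [Measure.addHaar_ball_of_pos μ _ (by positivity), mul_assoc, ← mul_pow,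
      ENNReal.ofReal_mul hb.le, ENNReal.ofReal_toReal measure_ball_lt_top.ne, mul_comm]
  · refine le_trans (le_of_eq ?_) hK
    calc b * 3 ^ n / (c * K⁻¹ ^ ((n : ℝ) - t)) * K⁻¹ ^ q
        = b * 3 ^ n / c * (K⁻¹ ^ q / K⁻¹ ^ ((n : ℝ) - t)) := by field_simp
      _ = _ := by
          rw [← Real.rpow_sub hl0, Real.inv_rpow hK0.le, ← Real.rpow_neg hK0.le]
          congr 2; ring

end

/-! ### Conclusion and degenerate cases -/

theorem AdmitsHardy.of_hardy_one {n : ℕ} {Ω : Set (EuclideanSpace ℝ (Fin n))} (hΩ : IsOpen Ω)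
    (hne : Ωᶜ.Nonempty) {p β : ℝ} (hp : 1 < p)
    (h : ∃ C : ℝ≥0, ∀ v : EuclideanSpace ℝ (Fin n) → ℝ, MemLipZero Ω v →
      ∫⁻ x, ‖v x‖ₑ * Metric.infEDist x Ωᶜ ^ (-(p - β)) ≤
        C * ∫⁻ x, ‖gradient v x‖ₑ * Metric.infEDist x Ωᶜ ^ (1 - (p - β))) :
    AdmitsHardy Ω p β := by
  obtain ⟨C, hC⟩ := h
  -- Adding 1 keeps the constant positive even if C = 0.
  refine ⟨(C * Real.toNNReal p) ^ p + 1, by positivity, fun u hu => ?_⟩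
  have key := hardy_of_hardy_one hΩ hne hp hC hu
  rw [neg_sub, sub_sub_cancel] at key
  refine key.trans ?_
  gcongr
  rw [ENNReal.coe_add, ENNReal.coe_rpow_of_nonneg _ (by linarith), ENNReal.coe_mul]
  exact le_self_add

theorem corollary1p3 (n : ℕ) (p β : ℝ) (hp : 1 < p) (hβ : β < p - 1)
    (Ω : Set (EuclideanSpace ℝ (Fin n))) (hΩ : IsOpen Ω)
    (hdim : upperAssouadDim Ωᶜ < (((n : ℝ) - p + β : ℝ) : EReal) ∨
      ((((n : ℝ) - p + β : ℝ) : EReal) < lowerAssouadDim Ωᶜ ∧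
        (¬ Bornology.IsBounded Ω → ¬ Bornology.IsBounded Ωᶜ))) :
    AdmitsHardy Ω p β := by
  rcases Ωᶜ.eq_empty_or_nonempty with h0 | hne
  -- With empty complement the distance is ⊤, and its negative power β - p annihilates the left
  -- side.
  · refine ⟨1, one_pos, fun u _ => ?_⟩
    simp [h0, ENNReal.top_rpow_of_neg (by linarith : β - p < 0)]
  have hq : 1 < p - β := by linarith
  have hfin : (Module.finrank ℝ (EuclideanSpace ℝ (Fin n)) : ℝ) = n := by simp
  rcases hdim with hdim | ⟨hdim, hunb⟩
  · obtain ⟨_, ⟨s, hs, rfl⟩, hlt⟩ := sInf_lt_iff.1 hdim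
    rw [EReal.coe_lt_coe_iff] at hlt
    exact AdmitsHardy.of_hardy_one hΩ hne hp
      (IsUpperAssouadExponent.hardy_one hΩ hne hq hs (by rw [hfin]; linarith))
  · obtain ⟨_, ⟨t, ht, rfl⟩, hlt⟩ := lt_sSup_iff.1 hdim
    rw [EReal.coe_lt_coe_iff] at hlt
    -- For n = 0 the whole space is bounded, so the unboundedness argument below fails; but then Ω
    -- is empty.
    rcases Nat.eq_zero_or_pos n with rfl | hn
    · have hΩ0 : Ω = ∅ := by
        obtain ⟨x, hx⟩ := hne
        exact Set.eq_empty_of_forall_notMem fun y hy => hx (Subsingleton.elim y x ▸ hy)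
      exact ⟨1, one_pos, fun u _ => by simp [hΩ0]⟩
    have hub : ¬ Bornology.IsBounded Ωᶜ := by
      by_cases hb : Bornology.IsBounded Ω
      · intro hbc
        have : Nonempty (Fin n) := ⟨⟨0, hn⟩⟩
        refine NormedSpace.unbounded_univ ℝ (EuclideanSpace ℝ (Fin n)) ?_
        rw [← Set.union_compl_self Ω]
        exact hb.union hbc
      · exact hunb hb
    have hed : Metric.ediam Ωᶜ = ⊤ := by
      rwa [Metric.isBounded_iff_ediam_ne_top, not_not] at hub
    exact AdmitsHardy.of_hardy_one hΩ hne hp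
      (IsLowerAssouadExponent.hardy_one hΩ hne hed hq ht (by rw [hfin]; linarith))
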